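/- A *space* is a $2$-dimensional $\mathbb{Q}$-vector subspace $V\subset\mathbb{C}$ containing two $\mathbb{R}$-linearly independent vectors. Two spaces $V_1,V_2$ are *homothetic* if $V_2=\lambda V_1$ for some $\lambda\in\mathbb{C}^*$. A space is *superrectangular* if it is homothetic to $\mathbb{Q}+\mathbb{Q}\tau$ for some root of unity $\tau$. Two nonzero vectors $v,w$ *form a rational angle* if $w/v\notin\mathbb{R}$ and $\arg(w/v)\in\mathbb{Q}\pi$; a *rational angle of $V$* is a pair $(v,w)$ of vectors of $V$ with this property, and two such pairs are *equivalent* if they determine the same two lines $\mathbb{R}v,\mathbb{R}w$ up to order. A *rational $n$-tuple* of $V$ is a set of $n$ nonzero vectors of $V$ any two of which form a rational angle; two rational $n$-tuples are *equivalent* if they span the same set of real lines. For integers $n_1,\dots,n_k\ge 2$, $V$ is *of type* $(n_1)+\dots+(n_k)$ if it contains rational $n_i$-tuples ($1\le i\le k$) that are pairwise disjoint as sets of lines. Types are ordered by $(n_1)+\dots+(n_k)\le(m_1)+\dots+(m_l)$ if there is a map $f:\{1,\dots,k\}\to\{1,\dots,l\}$ with $\sum_{f(i)=j}n_i\le m_j$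 for all $j$; a type is the *exact type* of $V$ if it is the largest of all types of $V$. **Theorem 7.1.** Let $V$ be a superrectangular space that is homothetic neither to $\mathbb{Q}(i)$ nor to $\mathbb{Q}(\sqrt{-3})$. Then $V$ has exact type $(4)$. That is, $V$ contains a rational $4$-tuple, any two rational $4$-tuples of $V$ are equivalent, and every rational angle of $V$ is equivalent to one formed by two vectors of this $4$-tuple. -/

import Mathlib

namespace RationalAngles

/-- A *space*: a two-dimensional rational vector space `V ⊆ ℂ` that contains two
`ℝ`-linearly independent vectors. -/
structure IsSpace (V : Submodule ℚ ℂ) : Prop where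
  finrank_eq : Module.finrank ℚ V = 2
  exists_indep : ∃ v ∈ V, ∃ w ∈ V, LinearIndependent ℝ ![v, w]

/-- The rational span of `1` and `τ`. -/
noncomputable def spaceOf (τ : ℂ) : Submodule ℚ ℂ := Submodule.span ℚ {1, τ}

/-- `V₂` is the image of `V₁` under a homothety `z ↦ l * z` with `l ≠ 0` complex. -/
def Homothetic (V₁ V₂ : Submodule ℚ ℂ) : Prop :=
  ∃ l : ℂ, l ≠ 0 ∧ V₂ = V₁.map (LinearMap.mulLeft ℚ l)

/-- A space is *superrectangular* if it is homothetic to the rational span of `1` and `τ`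
for a root of unity `τ`. -/
def IsSuperrectangular (V : Submodule ℚ ℂ) : Prop :=
  ∃ τ : ℂ, (∃ n : ℕ, 0 < n ∧ τ ^ n = 1) ∧ Homothetic V (spaceOf τ)

/-- The field `ℚ(i)`, as a space. -/
noncomputable def gaussianSpace : Submodule ℚ ℂ := spaceOf Complex.I

/-- The field `ℚ(√-3)`, as a space. -/
noncomputable def eisensteinSpace : Submodule ℚ ℂ := spaceOf ((Real.sqrt 3 : ℂ) * Complex.I)

/-- The real line through the origin spanned by `v`. -/
noncomputable def line (v : ℂ) : Submodule ℝ ℂ := Submodule.span ℝ {v}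

/-- The nonzero vectors `v`, `w` form a rational angle: `w / v` is not real and its argument is
a rational multiple of `π`. -/
def FormRationalAngle (v w : ℂ) : Prop :=
  v ≠ 0 ∧ w ≠ 0 ∧ (w / v).im ≠ 0 ∧ ∃ q : ℚ, (w / v).arg = (q : ℝ) * Real.pi

/-- Two angles are equivalent if they have the same two sides (as lines), possibly swapped. -/
def AngleEquiv (v w v' w' : ℂ) : Prop :=
  (line v = line v' ∧ line w = line w') ∨ (line v = line w' ∧ line w = line v')

/-- `T` is a rational `n`-tuple of `V`: a set of `n` nonzero vectors of `V`, any two of which form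
a rational angle. -/
def IsRationalTuple (V : Submodule ℚ ℂ) (n : ℕ) (T : Finset ℂ) : Prop :=
  T.card = n ∧ (∀ v ∈ T, v ∈ V ∧ v ≠ 0) ∧
    ∀ v ∈ T, ∀ w ∈ T, v ≠ w → FormRationalAngle v w

/-- The set of lines spanned by the vectors of a tuple. -/
def linesOf (T : Finset ℂ) : Set (Submodule ℝ ℂ) := line '' (T : Set ℂ)

/-- Two tuples are equivalent if they span the same set of lines. -/
def TupleEquiv (T T' : Finset ℂ) : Prop := linesOf T = linesOf T'

/-- `V` is of type `n₁ + ⋯ + nₖ` (given as the list `[n₁, …, nₖ]`, all `nᵢ ≥ 2`): it contains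
rational `nᵢ`-tuples, `i = 1, …, k`, that are pairwise disjoint as sets of lines. -/
def IsOfType (V : Submodule ℚ ℂ) (t : List ℕ) : Prop :=
  (∀ n ∈ t, 2 ≤ n) ∧
    ∃ T : Fin t.length → Finset ℂ,
      (∀ i, IsRationalTuple V (t.get i) (T i)) ∧
      ∀ i j, i ≠ j → Disjoint (linesOf (T i)) (linesOf (T j))

/-- The partial order on types: `s ≤ t` if the tuples of `s` can be distributed among those of `t`
so that the sizes of the tuples placed into one tuple of `t` add up to at most its size; that is,
disjoint tuples of the sizes in `s` can be chosen inside disjoint tuples of the sizes in `t`. -/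
def TypeLE (s t : List ℕ) : Prop :=
  ∃ f : Fin s.length → Fin t.length,
    ∀ j, ∑ i ∈ Finset.univ.filter (fun i => f i = j), s.get i ≤ t.get j

/-- `V` has exact type `t`: it is of type `t`, and `t` is the largest of all types of `V`. -/
def HasExactType (V : Submodule ℚ ℂ) (t : List ℕ) : Prop :=
  IsOfType V t ∧ ∀ s, IsOfType V s → TypeLE s t

end RationalAngles

/-! ### Lower bounds for Euler's totient. -/

namespace RationalAngles

open Polynomial

/-! Up to homothety `V` is `ℚ + ℚτ` with `τ` a primitive `n`-th root of unity. Orders 1 and 2 make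
`V` real, order 4 gives `ℚ(i)`, and orders 3 and 6 give `ℚ(√-3)`, so `n ≥ 5` and `n ≠ 6`. The
vectors `1`, `τ`, `1 + τ`, `1 - τ` are the sides and diagonals of a rhombus and form a rational
4-tuple. The claim is that every side of a rational angle lies on one of these four lines; the exact
type and both uniqueness statements then follow by counting lines.

Let `v = a + bτ`, `w = c + dτ`, and `A = ac + bd`, `B = ad`, `C = bc`, so that `w * conj v = A + Bτ
+ Cτ⁻¹`. The angle is rational iff `B ≠ C` and the quotient of this number by its conjugate is a
root of unity `μ`, that is, `C + Aτ + Bτ² = μ(B + Aτ + Cτ²)` (`formRationalAngle_coords_iff`).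
Moreover `A² - 4BC = (ac - bd)²` is a square. As `μ` lies in `ℚ(τ)`, it equals `±τ^k`, and the
equation becomes a sparse polynomial relation for `τ`. `isStandard_of_pow_eq_one` shows that it has
only the expected solutions `IsStandard`, and `IsStandard.eq_zero_or_eq` reads off `a + bτ` from
them.

For odd `n` the relation is compared with its conjugate under `τ ↦ τ²` (`isStandard_of_odd`); for `4
∣ n` with the one under `τ ↦ -τ` (`isStandard_of_four_dvd`); for `n = 2j`, `j` odd, `-τ` has odd
order. Small `n` are done by hand, and there the square condition removes spurious solutions. -/

theorem le_totient_sq (n : ℕ) (hn : n % 4 ≠ 2) : n ≤ n.totient ^ 2 := by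
  induction n using Nat.recOnPosPrimePosCoprime with
  | zero => simp
  | one => simp
  | prime_pow p k hp hk =>
    obtain ⟨k, rfl⟩ : ∃ j, k = j + 1 := ⟨k - 1, by omega⟩
    rw [Nat.totient_prime_pow_succ hp]
    obtain ⟨q, rfl⟩ : ∃ q, p = q + 1 := ⟨p - 1, by have := hp.pos; omega⟩
    have hq : 1 ≤ q := by have := hp.two_le; omega
    rw [Nat.add_sub_cancel]
    rcases k with _ | k
    · rcases Nat.lt_or_ge q 2 with h | h
      · obtain rfl : q = 1 := by omega
        simp at hn
      · simp only [zero_add, pow_one, pow_zero, one_mul]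
        nlinarith
    · have h1 : (q + 1) ^ (k + 2) ≤ ((q + 1) ^ (k + 1)) ^ 2 := by
        rw [← pow_mul]
        exact Nat.pow_le_pow_right (by omega) (by omega)
      calc (q + 1) ^ (k + 1 + 1) ≤ ((q + 1) ^ (k + 1)) ^ 2 * 1 := by simpa using h1
        _ ≤ ((q + 1) ^ (k + 1)) ^ 2 * q ^ 2 := Nat.mul_le_mul_left _ (Nat.one_le_pow _ _ hq)
        _ = _ := by ring
  | coprime a b ha hb hab iha ihb =>
    rw [Nat.totient_mul hab, mul_pow]
    -- A factor congruent to 2 mod 4 would have an odd cofactor, making the product 2 mod 4 as well.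
    have hodd : ¬ (a % 2 = 0 ∧ b % 2 = 0) := fun ⟨h1, h2⟩ => by
      have := Nat.dvd_gcd (Nat.dvd_of_mod_eq_zero h1) (Nat.dvd_of_mod_eq_zero h2)
      rw [hab] at this
      omega
    have key : a * b % 4 = (a % 4) * (b % 4) % 4 := Nat.mul_mod a b 4
    have ha4 : a % 4 < 4 := Nat.mod_lt _ (by norm_num)
    have hb4 : b % 4 < 4 := Nat.mod_lt _ (by norm_num)
    refine Nat.mul_le_mul (iha fun h => hn ?_) (ihb fun h => hn ?_)
    · have : b % 4 = 1 ∨ b % 4 = 3 := by omega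
      rcases this with h' | h' <;> rw [key, h, h']
    · have : a % 4 = 1 ∨ a % 4 = 3 := by omega
      rcases this with h' | h' <;> rw [key, h, h']

theorem odd_of_totient_le_eight {n : ℕ} (hodd : Odd n) (h : n.totient ≤ 8) :
    n = 1 ∨ n = 3 ∨ n = 5 ∨ n = 7 ∨ n = 9 ∨ n = 15 := by
  have h1 := le_totient_sq n (by have := Nat.odd_iff.mp hodd; omega)
  have h2 : n ≤ 64 := h1.trans (Nat.pow_le_pow_left h 2)
  have key : ∀ m < 65, m % 2 = 1 → m.totient ≤ 8 →
      m = 1 ∨ m = 3 ∨ m = 5 ∨ m = 7 ∨ m = 9 ∨ m = 15 := by decide +kernel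
  exact key n (by omega) (Nat.odd_iff.mp hodd) h

theorem four_dvd_of_totient_le_four {n : ℕ} (hn : 4 ∣ n) (hn0 : n ≠ 0) (h : n.totient ≤ 4) :
    n = 4 ∨ n = 8 ∨ n = 12 := by
  have h1 := le_totient_sq n (by omega)
  have h2 : n ≤ 16 := h1.trans (Nat.pow_le_pow_left h 2)
  have key : ∀ m < 17, m ≠ 0 → m % 4 = 0 → m.totient ≤ 4 → m = 4 ∨ m = 8 ∨ m = 12 := by
    decide +kernel
  exact key n (by omega) hn0 (by omega) h

/-! ### Galois conjugation of `τ`, and the roots of unity in `ℚ(τ)`. -/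

section Conjugation

variable {n : ℕ} {τ : ℂ}

theorem cyclotomic_dvd_of_aeval_eq_zero (hτ : IsPrimitiveRoot τ n) (hn : 0 < n) {P : ℚ[X]}
    (h : aeval τ P = 0) : cyclotomic n ℚ ∣ P := by
  rw [cyclotomic_eq_minpoly_rat hτ hn]
  exact minpoly.dvd ℚ τ h

theorem aeval_pow_eq_zero (hτ : IsPrimitiveRoot τ n) (hn : 0 < n) {P : ℚ[X]}
    (h : aeval τ P = 0) {τ' : ℂ} (hτ' : IsPrimitiveRoot τ' n) : aeval τ' P = 0 := by
  obtain ⟨Q, rfl⟩ := cyclotomic_dvd_of_aeval_eq_zero hτ hn h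
  rw [map_mul, cyclotomic_eq_minpoly_rat hτ' hn, minpoly.aeval, zero_mul]

theorem eq_zero_of_natDegree_lt_totient (hτ : IsPrimitiveRoot τ n) (hn : 0 < n) {P : ℚ[X]}
    (h : aeval τ P = 0) (hdeg : P.natDegree < n.totient) : P = 0 := by
  by_contra hP
  have := natDegree_le_of_dvd (cyclotomic_dvd_of_aeval_eq_zero hτ hn h) hP
  rw [natDegree_cyclotomic] at this
  omega

/-- Since `τ^(n/2) = -1`, one has `-τ = τ^(n/2 + 1)`, and `n/2 + 1` is prime to `n` because `n/2` is
even. -/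
theorem neg_of_four_dvd (hτ : IsPrimitiveRoot τ n) (hn : 0 < n) (h4 : 4 ∣ n) :
    IsPrimitiveRoot (-τ) n := by
  obtain ⟨m, rfl⟩ := h4
  have h2 : τ ^ (2 * m) = -1 := by
    have h1 : IsPrimitiveRoot (τ ^ (2 * m)) 2 := hτ.pow hn (by ring)
    exact h1.eq_neg_one_of_two_right
  have h3 : -τ = τ ^ (2 * m + 1) := by rw [pow_succ, h2]; ring
  rw [h3]
  refine hτ.pow_of_coprime _ ?_
  have : Nat.Coprime (2 * m + 1) (2 * m) := by simp
  have h5 : Nat.Coprime (2 * m + 1) 2 := by simp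
  rw [show 4 * m = 2 * (2 * m) by ring]
  exact h5.mul_right this

open IntermediateField in
-- The torsion of the `n`-th cyclotomic field has order `n` or `2n` according to the parity of `n`;
-- for odd `n` the extra roots are the negatives of powers of `τ`.
theorem exists_eq_mul_pow_of_mem_adjoin (hτ : IsPrimitiveRoot τ n) (hn : 0 < n) {μ : ℂ}
    (hμ : μ ∈ ℚ⟮τ⟯) {m : ℕ} (hm : 0 < m) (hm1 : μ ^ m = 1) :
    ∃ (ε : ℚ) (k : ℕ), (ε = 1 ∨ ε = -1) ∧ k < n ∧ μ = ε * τ ^ k := by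
  have : NeZero n := ⟨hn.ne'⟩
  have hint : IsIntegral ℚ τ := (hτ.isIntegral hn).tower_top
  have : IsCyclotomicExtension {n} ℚ ℚ⟮τ⟯ := by
    change IsCyclotomicExtension {n} ℚ ℚ⟮τ⟯.toSubalgebra
    rw [adjoin_simple_toSubalgebra_of_isAlgebraic hint.isAlgebraic]
    exact hτ.adjoin_isCyclotomicExtension ℚ
  have : NumberField ℚ⟮τ⟯ := IsCyclotomicExtension.numberField {n} ℚ _
  have hm2 : (⟨μ, hμ⟩ : ℚ⟮τ⟯) ^ m = 1 := by ext; simpa using hm1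
  obtain ⟨l, hl, hroot⟩ : ∃ l, l ≠ 0 ∧ IsPrimitiveRoot (⟨μ, hμ⟩ : ℚ⟮τ⟯) l :=
    ⟨orderOf _, (isOfFinOrder_iff_pow_eq_one.mpr ⟨m, hm, hm2⟩).orderOf_pos.ne',
      IsPrimitiveRoot.orderOf _⟩
  have : NeZero l := ⟨hl⟩
  have hdvd := NumberField.Units.dvd_torsionOrder_of_isPrimitiveRoot hroot
  rw [IsCyclotomicExtension.Rat.torsionOrder_eq (n := n)] at hdvd
  have hpow : ∀ N, l ∣ N → μ ^ N = 1 := by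
    rintro N ⟨r, rfl⟩
    have h2 : (⟨μ, hμ⟩ : ℚ⟮τ⟯) ^ (l * r) = 1 := by rw [pow_mul, hroot.pow_eq_one, one_pow]
    simpa using congrArg (algebraMap ℚ⟮τ⟯ ℂ) h2
  by_cases hn1 : μ ^ n = 1
  · obtain ⟨k, hk, rfl⟩ := hτ.eq_pow_of_pow_eq_one hn1
    exact ⟨1, k, Or.inl rfl, hk, by simp⟩
  · have hodd : ¬ Even n := fun he => hn1 (hpow n (by simpa [he] using hdvd))
    have h1 : μ ^ (2 * n) = 1 := hpow _ (by simpa [hodd] using hdvd)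
    have h2 : (μ ^ n - 1) * (μ ^ n + 1) = 0 := by linear_combination h1
    have h3 : μ ^ n = -1 := by
      rcases mul_eq_zero.mp h2 with h | h
      · exact absurd (sub_eq_zero.mp h) hn1
      · linear_combination h
    have h4 : (-μ) ^ n = 1 := by
      rw [(Nat.not_even_iff_odd.mp hodd).neg_pow, h3, neg_neg]
    obtain ⟨k, hk, hk'⟩ := hτ.eq_pow_of_pow_eq_one h4
    exact ⟨-1, k, Or.inr rfl, hk, by rw [hk']; simp⟩

end Conjugation

end RationalAngles

/-! ### The equation for `τ` of odd order. -/

namespace RationalAngles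

open Polynomial

/-- The coefficient vectors `(A, B, C)` of `(c + d τ) (a + b τ⁻¹) = A + B τ + C τ⁻¹` that occur
when both `a + b τ` and `c + d τ` are rational multiples of `1`, `τ`, `1 + τ` or `1 - τ`. -/
def IsStandard (A B C : ℚ) : Prop :=
  (C = 0 ∧ (A = 0 ∨ A ^ 2 = B ^ 2)) ∨ (B = 0 ∧ (A = 0 ∨ A ^ 2 = C ^ 2)) ∨ (A = 0 ∧ B = -C)

theorem IsStandard.swap {A B C : ℚ} (h : IsStandard A B C) : IsStandard A C B := by
  rcases h with h | h | ⟨h, h'⟩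
  · exact Or.inr (Or.inl h)
  · exact Or.inl h
  · exact Or.inr (Or.inr ⟨h, by linarith⟩)

section Odd

variable {n : ℕ} {τ : ℂ}

theorem coeff_eq_zero_of_sum_eq_zero (hτ : IsPrimitiveRoot τ n) (hn : 0 < n) {d : ℕ}
    (hd : d ≤ n.totient) (c : Fin d → ℚ) (h : ∑ i, (c i : ℂ) * τ ^ (i : ℕ) = 0) (i : Fin d) :
    c i = 0 := by
  have hd0 : 0 < d := i.pos
  set P : ℚ[X] := ∑ i : Fin d, Polynomial.C (c i) * X ^ (i : ℕ) with hP
  have hP0 : P = 0 := by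
    refine eq_zero_of_natDegree_lt_totient hτ hn (by simpa [hP] using h) ?_
    refine lt_of_le_of_lt (natDegree_sum_le_of_forall_le (n := d - 1) _ _ fun j _ => ?_)
      (by omega)
    exact (natDegree_C_mul_X_pow_le _ _).trans (by omega)
  have := congrArg (fun Q => Q.coeff (i : ℕ)) hP0
  simpa [hP, coeff_X_pow, Fin.val_inj, finsetSum_coeff] using this

variable {A B C ε : ℚ} {k : ℕ}

/-- The relation has degree at most `k + 2`, below that of the minimal polynomial of `τ`, so it
holds coefficientwise. -/
theorem isStandard_of_add_two_lt (hτ : IsPrimitiveRoot τ n) (hn : 0 < n) (hBC : B ≠ C)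
    (hε : ε = 1 ∨ ε = -1) (hk : k + 2 < n.totient)
    (h : (C : ℂ) + A * τ + B * τ ^ 2 = ε * τ ^ k * (B + A * τ + C * τ ^ 2)) :
    IsStandard A B C := by
  set P : ℚ[X] := Polynomial.C C + Polynomial.C A * X + Polynomial.C B * X ^ 2
    - X ^ k * (Polynomial.C (ε * B) + Polynomial.C (ε * A) * X + Polynomial.C (ε * C) * X ^ 2)
    with hP
  have hP0 : P = 0 := by
    refine eq_zero_of_natDegree_lt_totient hτ hn ?_ (lt_of_le_of_lt ?_ hk)
    · simp only [hP, map_sub, map_add, map_mul, map_pow, aeval_C, aeval_X, eq_ratCast]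
      linear_combination h
    · rw [hP]; compute_degree
  have hco : ∀ i, P.coeff i = 0 := fun i => by rw [hP0, coeff_zero]
  have c0 := hco 0
  have c1 := hco 1
  have c2 := hco 2
  rcases k with _ | _ | _ | k
  · simp [-map_mul, hP, coeff_X, coeff_C, coeff_X_pow] at c0 c1 c2
    rcases hε with rfl | rfl
    · exact absurd (by linarith) hBC
    · exact Or.inr (Or.inr ⟨by linarith, by linarith⟩)
  · simp [-map_mul, hP, coeff_X, coeff_C, coeff_X_pow] at c0 c1 c2
    refine Or.inl ⟨c0, Or.inr ?_⟩
    rcases hε with rfl | rfl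
    · rw [show A = B by linarith]
    · rw [show A = -B by linarith]; ring
  · simp [-map_mul, hP, coeff_X, coeff_C, coeff_X_pow, coeff_X_pow_mul'] at c0 c1 c2
    exact Or.inl ⟨c0, Or.inl c1⟩
  · simp [-map_mul, hP, coeff_X, coeff_C, coeff_X_pow, coeff_X_pow_mul'] at c0 c1 c2
    exact Or.inl ⟨c0, Or.inl c1⟩

theorem isStandard_of_odd_of_eight_lt (hτ : IsPrimitiveRoot τ n) (hodd : Odd n)
    (h8 : 8 < n.totient) (hBC : B ≠ C) (hε : ε = 1 ∨ ε = -1)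
    (h : (C : ℂ) + A * τ + B * τ ^ 2 = ε * τ ^ k * (B + A * τ + C * τ ^ 2)) :
    IsStandard A B C := by
  have hn : 0 < n := hodd.pos
  have hsq : (C : ℂ) + A * τ ^ 2 + B * (τ ^ 2) ^ 2
      = ε * (τ ^ 2) ^ k * (B + A * τ ^ 2 + C * (τ ^ 2) ^ 2) := by
    have := aeval_pow_eq_zero hτ hn (P := Polynomial.C C + Polynomial.C A * X
      + Polynomial.C B * X ^ 2 - Polynomial.C ε * X ^ k *
        (Polynomial.C B + Polynomial.C A * X + Polynomial.C C * X ^ 2)) (by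
      simp only [map_sub, map_add, map_mul, map_pow, aeval_C, aeval_X, eq_ratCast]
      linear_combination h) (hτ.pow_of_coprime 2 (Nat.coprime_two_left.mpr hodd))
    simp only [map_sub, map_add, map_mul, map_pow, aeval_C, aeval_X, eq_ratCast] at this
    linear_combination this
  have hε2 : (ε : ℂ) ^ 2 = 1 := by rcases hε with rfl | rfl <;> simp
  -- The relation squared and its conjugate at `τ²` both involve `τ^(2k)`; eliminating it leaves a
  -- relation of degree 8 independent of `k`.
  have hrel : ((C : ℂ) + A * τ ^ 2 + B * τ ^ 4) * (B + A * τ + C * τ ^ 2) ^ 2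
      - ε * (B + A * τ ^ 2 + C * τ ^ 4) * (C + A * τ + B * τ ^ 2) ^ 2 = 0 := by
    rw [h]
    linear_combination (B + A * τ + C * τ ^ 2) ^ 2 * hsq
      - ε * τ ^ (2 * k) * (B + A * τ + C * τ ^ 2) ^ 2 * (B + A * τ ^ 2 + C * τ ^ 4) * hε2
  have hc := coeff_eq_zero_of_sum_eq_zero hτ hn (d := 9) h8
    ![C * B ^ 2 - ε * (B * C ^ 2), 2 * A * B * C - ε * (2 * A * B * C),
      C * (A ^ 2 + 2 * B * C) + A * B ^ 2 - ε * (B * (A ^ 2 + 2 * B * C) + A * C ^ 2),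
      2 * A * C ^ 2 + 2 * A ^ 2 * B - ε * (2 * A * B ^ 2 + 2 * A ^ 2 * C),
      C ^ 3 + A * (A ^ 2 + 2 * B * C) + B ^ 3 - ε * (B ^ 3 + A * (A ^ 2 + 2 * B * C) + C ^ 3),
      2 * A ^ 2 * C + 2 * A * B ^ 2 - ε * (2 * A ^ 2 * B + 2 * A * C ^ 2),
      A * C ^ 2 + B * (A ^ 2 + 2 * B * C) - ε * (A * B ^ 2 + C * (A ^ 2 + 2 * B * C)),
      2 * A * B * C - ε * (2 * A * B * C), B * C ^ 2 - ε * (C * B ^ 2)] (by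
    simp only [Fin.sum_univ_succ, Fin.sum_univ_zero]
    simp
    linear_combination hrel)
  have c0 := hc 0
  have c1 := hc 1
  have c6 := hc 6
  have c2 := hc 2
  simp at c0 c1 c2 c6
  have hA : ∀ {x y : ℚ}, A * (x * y) = 0 → x ≠ 0 → A = 0 ∨ y = 0 := fun h h' => by
    simpa [h'] using h
  rcases hε with rfl | rfl
  · have h0 : (C * B) * (B - C) = 0 := by linear_combination c0
    rcases mul_eq_zero.mp h0 with h0 | h0
    · rcases mul_eq_zero.mp h0 with rfl | rfl
      · have : A * (B * (A - B)) = 0 := by linear_combination c6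
        refine Or.inl ⟨rfl, (hA this hBC).imp_right fun h => ?_⟩
        rw [sub_eq_zero.mp h]
      · have : A * (C * (A - C)) = 0 := by linear_combination c2
        refine Or.inr (Or.inl ⟨rfl, (hA this hBC.symm).imp_right fun h => ?_⟩)
        rw [sub_eq_zero.mp h]
    · exact absurd (sub_eq_zero.mp h0) hBC
  · have h0 : (C * B) * (B + C) = 0 := by linear_combination c0
    rcases mul_eq_zero.mp h0 with h0 | h0
    · rcases mul_eq_zero.mp h0 with rfl | rfl
      · have : A * (B * (A + B)) = 0 := by linear_combination c6
        refine Or.inl ⟨rfl, (hA this hBC).imp_right fun h => ?_⟩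
        rw [eq_neg_of_add_eq_zero_left h]; ring
      · have : A * (C * (A + C)) = 0 := by linear_combination c2
        refine Or.inr (Or.inl ⟨rfl, (hA this hBC.symm).imp_right fun h => ?_⟩)
        rw [eq_neg_of_add_eq_zero_left h]; ring
    · have hB : B = -C := eq_neg_of_add_eq_zero_left h0
      refine Or.inr (Or.inr ⟨?_, hB⟩)
      have hC : C ≠ 0 := fun h => hBC (by rw [hB, h, neg_zero])
      have : A * (C ^ 2) = 0 := by
        rw [hB] at c1; linear_combination - c1 / 4
      simpa [hC] using this

theorem isStandard_of_odd_of_le (hτ : IsPrimitiveRoot τ n) (hodd : Odd n) (h5 : 5 ≤ n)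
    (hBC : B ≠ C) (hsq : IsSquare (A ^ 2 - 4 * B * C)) (hε : ε = 1 ∨ ε = -1) (hk : 2 * k ≤ n)
    (h : (C : ℂ) + A * τ + B * τ ^ 2 = ε * τ ^ k * (B + A * τ + C * τ ^ 2)) :
    IsStandard A B C := by
  have hn : 0 < n := hodd.pos
  rcases lt_or_ge 8 n.totient with h8 | h8
  · exact isStandard_of_odd_of_eight_lt hτ hodd h8 hBC hε h
  by_cases hk2 : k + 2 < n.totient
  · exact isStandard_of_add_two_lt hτ hn hBC hε hk2 h
  have hroot : eval₂ (Int.castRingHom ℂ) τ (cyclotomic n ℤ) = 0 := by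
    have h1 := hτ.isRoot_cyclotomic hn
    rwa [← map_cyclotomic n (Int.castRingHom ℂ), IsRoot.def, eval_map] at h1
  have hε0 : ε ≠ 0 := by rcases hε with rfl | rfl <;> norm_num
  have t5 : Nat.totient 5 = 4 := by decide
  have t7 : Nat.totient 7 = 6 := by decide
  have t9 : Nat.totient 9 = 6 := by decide
  have t15 : Nat.totient 15 = 8 := by decide
  -- Now `φ(n) - 2 ≤ k ≤ n/2`, which leaves `n = 5, k = 2`, then `n = 9, k = 4`, and `n = 15, k = 6`
  -- or `7`. The cyclotomic relation brings each below degree `φ(n)`.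
  rcases odd_of_totient_le_eight hodd h8 with rfl | rfl | rfl | rfl | rfl | rfl
  · omega
  · omega
  · obtain rfl : k = 2 := by omega
    have hΦ : 1 + τ + τ ^ 2 + τ ^ 3 + τ ^ 4 = 0 := by
      have := hτ.geom_sum_eq_zero (by norm_num)
      simpa [Finset.sum_range_succ] using this
    have hc := coeff_eq_zero_of_sum_eq_zero hτ hn (d := 4) t5.ge
      ![C + ε * C, A + ε * C, B - ε * B + ε * C, -ε * A + ε * C] (by
      simp only [Fin.sum_univ_succ, Fin.sum_univ_zero]
      simp
      linear_combination h + ε * C * hΦ)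
    have c0 := hc 0
    have c1 := hc 1
    have c2 := hc 2
    simp at c0 c1 c2
    rcases hε with rfl | rfl
    · exact Or.inl ⟨by linarith, Or.inl (by linarith)⟩
    -- The solutions `A = C = 2B` are genuine; they are excluded only because `A² - 4BC = -4B²` must
    -- be a square.
    · obtain ⟨r, hr⟩ := hsq
      have hA : A = C := by linarith
      have hC : C = 2 * B := by linarith
      have hB : B = 0 := by
        rw [hA, hC] at hr
        nlinarith [mul_self_nonneg r, mul_self_nonneg B]
      exact absurd (by rw [hC, hB]; ring) hBC
  · omega
  · obtain rfl : k = 4 := by omega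
    have hΦ : 1 + τ ^ 3 + τ ^ 6 = 0 := by
      have := (hτ.pow (a := 3) hn (by norm_num : 9 = 3 * 3)).geom_sum_eq_zero (by norm_num)
      simp [Finset.sum_range_succ] at this
      linear_combination this
    have hc := coeff_eq_zero_of_sum_eq_zero hτ hn (d := 6) t9.ge
      ![C + ε * C, A, B, ε * C, -ε * B, -ε * A] (by
      simp only [Fin.sum_univ_succ, Fin.sum_univ_zero]
      simp
      linear_combination h + ε * C * hΦ)
    have c1 := hc 1
    have c3 := hc 3
    simp [hε0] at c1 c3
    exact Or.inl ⟨c3, Or.inl c1⟩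
  · have hΦ : 1 - τ + τ ^ 3 - τ ^ 4 + τ ^ 5 - τ ^ 7 + τ ^ 8 = 0 := by
      have h5 : 1 + τ ^ 5 + τ ^ 10 = 0 := by
        have := (hτ.pow (a := 5) hn (by norm_num : 15 = 5 * 3)).geom_sum_eq_zero (by norm_num)
        simp [Finset.sum_range_succ] at this
        linear_combination this
      have h3 : 1 + τ + τ ^ 2 ≠ 0 := fun h0 => by
        have : τ ^ 3 = 1 := by linear_combination (τ - 1) * h0
        have := hτ.dvd_of_pow_eq_one 3 this
        omega
      refine (mul_eq_zero.mp (?_ : (1 + τ + τ ^ 2) * _ = 0)).resolve_left h3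
      linear_combination h5
    obtain rfl | rfl : k = 6 ∨ k = 7 := by omega
    · have hc := coeff_eq_zero_of_sum_eq_zero hτ hn (d := 8) t15.ge
        ![C + ε * C, A - ε * C, B, ε * C, -ε * C, ε * C, -ε * B, -ε * A - ε * C] (by
        simp only [Fin.sum_univ_succ, Fin.sum_univ_zero]
        simp
        linear_combination h + ε * C * hΦ)
      have c1 := hc 1
      have c3 := hc 3
      simp [hε0] at c3
      simp [c3] at c1
      exact Or.inl ⟨c3, Or.inl c1⟩
    · have hc := coeff_eq_zero_of_sum_eq_zero hτ hn (d := 8) t15.ge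
        ![C + ε * (A + C), A - ε * (A + C) + ε * C, B - ε * C, ε * (A + C),
          -ε * (A + C) + ε * C, ε * (A + C) - ε * C, ε * C, -ε * B - ε * (A + C)] (by
        simp only [Fin.sum_univ_succ, Fin.sum_univ_zero]
        simp
        linear_combination h + ε * (A + C) * hΦ + ε * C * τ * hΦ)
      have c6 := hc 6
      have c3 := hc 3
      simp [hε0] at c3 c6
      simp [c6] at c3
      exact Or.inl ⟨c6, Or.inl c3⟩

theorem isStandard_of_odd (hτ : IsPrimitiveRoot τ n) (hodd : Odd n) (h5 : 5 ≤ n)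
    (hBC : B ≠ C) (hsq : IsSquare (A ^ 2 - 4 * B * C)) (hε : ε = 1 ∨ ε = -1) (hk : k < n)
    (h : (C : ℂ) + A * τ + B * τ ^ 2 = ε * τ ^ k * (B + A * τ + C * τ ^ 2)) :
    IsStandard A B C := by
  rcases le_or_gt (2 * k) n with h2 | h2
  · exact isStandard_of_odd_of_le hτ hodd h5 hBC hsq hε h2 h
  -- Dividing by `ετ^k` replaces `k` by `n - k` and exchanges `B` and `C`.
  · refine (isStandard_of_odd_of_le hτ hodd h5 hBC.symm (by convert hsq using 1; ring) hε
      (k := n - k) (by omega) ?_).swap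
    have hε2 : (ε : ℂ) ^ 2 = 1 := by rcases hε with rfl | rfl <;> simp
    have h1 : τ ^ (n - k) * τ ^ k = 1 := by
      rw [← pow_add, Nat.sub_add_cancel hk.le, hτ.pow_eq_one]
    linear_combination (-ε * τ ^ (n - k)) * h
      - (B + A * τ + C * τ ^ 2) * (ε ^ 2 * h1 + hε2)

end Odd

end RationalAngles

/-! ### The equation for `τ` of order divisible by 4. -/

namespace RationalAngles

open IntermediateField in
-- Every conjugate of `ν - 1` has absolute value at most 2, so every conjugate of `z` has absolute
-- value at most `1/2`. By Kronecker a nonzero such `z` would be a root of unity, of absolute value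
-- 1.
theorem eq_one_of_sub_one_eq_mul {ν z : ℂ} {m : ℕ} (hm : 0 < m) (hν : ν ^ m = 1)
    (hz : IsIntegral ℤ z) {N : ℤ} (hN : 4 ≤ N) (h : ν - 1 = N * z) : ν = 1 := by
  have hNC : (N : ℂ) ≠ 0 := by exact_mod_cast (by omega : N ≠ 0)
  by_contra hne
  have hz0 : z ≠ 0 := fun h0 => hne (by linear_combination h + N * h0)
  have hint : IsIntegral ℚ ν := ⟨Polynomial.X ^ m - 1,
    Polynomial.monic_X_pow_sub_C (1 : ℚ) hm.ne', by simp [hν]⟩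
  have : FiniteDimensional ℚ ℚ⟮ν⟯ := adjoin.finiteDimensional hint
  have : NumberField ℚ⟮ν⟯ := ⟨⟩
  have hzeq : z = (ν - 1) / N := by field_simp; linear_combination -h
  have hzmem : z ∈ ℚ⟮ν⟯ := by
    rw [hzeq]
    exact div_mem (sub_mem (mem_adjoin_simple_self ℚ ν) (one_mem _)) (intCast_mem _ _)
  set z' : ℚ⟮ν⟯ := ⟨z, hzmem⟩ with hz'
  set ν' : ℚ⟮ν⟯ := ⟨ν, mem_adjoin_simple_self ℚ ν⟩ with hν'
  have hrel : ν' - 1 = N * z' := by ext; simpa [hν', hz'] using h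
  have hpow : ν' ^ m = 1 := by ext; simpa [hν'] using hν
  have hz'int : IsIntegral ℤ z' :=
    (isIntegral_algebraMap_iff (algebraMap ℚ⟮ν⟯ ℂ).injective).mp hz
  have hbound : ∀ φ : ℚ⟮ν⟯ →+* ℂ, ‖φ z'‖ ≤ 1 / 2 := fun φ => by
    have h1 : φ ν' - 1 = N * φ z' := by simpa using congrArg φ hrel
    have h2 : ‖φ ν'‖ = 1 :=
      Complex.norm_eq_one_of_pow_eq_one (by rw [← map_pow, hpow, map_one]) hm.ne'
    have h3 : ‖φ ν' - 1‖ ≤ 2 := by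
      refine (norm_sub_le _ _).trans ?_
      rw [h2, norm_one]; norm_num
    rw [h1, norm_mul, Complex.norm_intCast] at h3
    have h4 : (4 : ℝ) ≤ |(N : ℝ)| := le_trans (by exact_mod_cast hN) (le_abs_self _)
    nlinarith [norm_nonneg (φ z')]
  obtain ⟨j, hj, hj1⟩ := NumberField.Embeddings.pow_eq_one_of_norm_le_one ℚ⟮ν⟯ ℂ
    (fun h0 => hz0 (by simpa [hz'] using congrArg (algebraMap ℚ⟮ν⟯ ℂ) h0)) hz'int
    (fun φ => (hbound φ).trans (by norm_num))
  have h1 : ‖algebraMap ℚ⟮ν⟯ ℂ z'‖ = 1 :=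
    Complex.norm_eq_one_of_pow_eq_one (by rw [← map_pow, hj1, map_one]) hj.ne'
  have := hbound (algebraMap ℚ⟮ν⟯ ℂ)
  linarith

/-- If `(C + B s) / (B + C s)` is a root of unity and `-B C` is a square, then `B = -C`. -/
theorem eq_neg_of_isSquare {s μ : ℂ} {m : ℕ} (hm : 0 < m) (hs : s ^ m = 1) (hμ : μ ^ m = 1)
    (hs2 : s ^ 2 ≠ 1) {B C : ℚ} (hB : B ≠ 0) (hC : C ≠ 0) (hsq : IsSquare (-4 * B * C))
    (h : (C : ℂ) + B * s = μ * (B + C * s)) : B = -C := by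
  obtain ⟨q, hq⟩ := hsq
  set r : ℚ := q / (2 * C) with hr
  have hBr : B = -(r ^ 2 * C) := by
    rw [hr]; field_simp; linear_combination -hq
  set x : ℤ := r.num
  set y : ℤ := (r.den : ℤ)
  have hy : y ≠ 0 := by simp [y]
  have hr0 : r ≠ 0 := fun h0 => hB (by rw [hBr, h0]; ring)
  have hx : x ≠ 0 := by simpa [x] using hr0
  have hrxy : (y : ℚ) * r = x := by simp [x, y, Rat.den_mul_eq_num]
  have hcop : IsCoprime (x ^ 2) (y ^ 2) := by
    refine IsCoprime.pow ?_
    rw [Int.isCoprime_iff_gcd_eq_one]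
    exact r.reduced
  have hCC : (C : ℂ) ≠ 0 := by exact_mod_cast hC
  -- With `B = -(x/y)²C`, coprimality makes `x²` divide `μs - 1` and `y²` divide `μ - s` in the
  -- algebraic integers, with the common quotient `u(μs - 1) + v(μ - s)`. If `x²` or `y²` exceeds 1,
  -- then `μs = 1` and `μ = s`, contradicting `s² ≠ 1`.
  have key : (y : ℂ) ^ 2 * (μ * s - 1) = x ^ 2 * (μ - s) := by
    have hrC : (y : ℂ) * r = x := by exact_mod_cast congrArg (fun t : ℚ => (t : ℂ)) hrxy
    rw [hBr] at h
    push_cast at h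
    refine mul_left_cancel₀ hCC ?_
    rw [← hrC]
    linear_combination (-(y : ℂ) ^ 2) * h
  have hsint : IsIntegral ℤ s := ⟨Polynomial.X ^ m - 1,
    Polynomial.monic_X_pow_sub_C (1 : ℤ) hm.ne', by simp [hs]⟩
  have hμint : IsIntegral ℤ μ := ⟨Polynomial.X ^ m - 1,
    Polynomial.monic_X_pow_sub_C (1 : ℤ) hm.ne', by simp [hμ]⟩
  have hs0 : s ≠ 0 := fun h0 => by simp [h0, hm.ne'] at hs
  have hyC : (y : ℂ) ≠ 0 := by exact_mod_cast hy
  have hxC : (x : ℂ) ≠ 0 := by exact_mod_cast hx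
  obtain ⟨u, v, huv⟩ := hcop
  have huvC : (u : ℂ) * x ^ 2 + v * y ^ 2 = 1 := by
    exact_mod_cast congrArg (fun t : ℤ => (t : ℂ)) huv
  have hcontra : ¬ (μ * s = 1 ∧ μ = s) := fun ⟨h1, h2⟩ => hs2 (by rw [← h1, h2]; ring)
  have hint : IsIntegral ℤ ((u : ℂ) * (μ * s - 1) + v * (μ - s)) :=
    ((isIntegral_algebraMap (x := u)).mul ((hμint.mul hsint).sub isIntegral_one)).add
      ((isIntegral_algebraMap (x := v)).mul (hμint.sub hsint))
  have four_le : ∀ {w : ℤ}, w ≠ 0 → w ^ 2 ≠ 1 → 4 ≤ w ^ 2 := fun {w} h0 h1 => by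
    have h2 : 2 ≤ |w| := by
      by_contra hlt
      have : |w| = 1 := by have := abs_pos.mpr h0; omega
      exact h1 (by rw [← sq_abs, this]; norm_num)
    rw [← sq_abs]; nlinarith
  have hx1 : x ^ 2 = 1 := by
    by_contra hne
    have h1 : μ * s = 1 := eq_one_of_sub_one_eq_mul hm (by rw [mul_pow, hs, hμ, one_mul]) hint
      (four_le hx hne) (by push_cast; linear_combination v * key - (μ * s - 1) * huvC)
    refine hcontra ⟨h1, ?_⟩
    rw [h1, sub_self, mul_zero] at key
    have := (mul_eq_zero.mp key.symm).resolve_left (pow_ne_zero 2 hxC)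
    exact sub_eq_zero.mp this
  have hy1 : y ^ 2 = 1 := by
    by_contra hne
    have h1 : μ * s⁻¹ = 1 := by
      have hsinv : s⁻¹ ^ m = 1 := by rw [inv_pow, hs, inv_one]
      have hsinvint : IsIntegral ℤ s⁻¹ := ⟨Polynomial.X ^ m - 1,
        Polynomial.monic_X_pow_sub_C (1 : ℤ) hm.ne', by simp [hs]⟩
      refine eq_one_of_sub_one_eq_mul hm (by rw [mul_pow, hsinv, hμ, one_mul])
        (hint.mul hsinvint) (four_le hy hne) ?_
      have : μ * s⁻¹ - 1 = (μ - s) * s⁻¹ := by field_simp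
      rw [this]
      push_cast
      linear_combination s⁻¹ * (-u * key - (μ - s) * huvC)
    have h2 : μ = s := by field_simp at h1; exact h1
    refine hcontra ⟨?_, h2⟩
    rw [h2, sub_self, mul_zero] at key
    rw [h2]
    have := (mul_eq_zero.mp key).resolve_left (pow_ne_zero 2 hyC)
    exact sub_eq_zero.mp this
  have hr1 : r ^ 2 = 1 := by
    have h1 : (x : ℚ) ^ 2 = 1 := by exact_mod_cast hx1
    have h2 : (y : ℚ) ^ 2 = 1 := by exact_mod_cast hy1
    rw [← hrxy] at h1
    linear_combination h1 - r ^ 2 * h2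
  rw [hBr, hr1, one_mul]

section FourDvd

variable {n : ℕ} {τ : ℂ} {A B C ε : ℚ} {k : ℕ}

theorem isStandard_of_four_dvd_of_eq (hτ : IsPrimitiveRoot τ n) (hn : 8 ≤ n) (h4 : 4 ∣ n)
    (hBC : B ≠ C) (hsq : IsSquare (A ^ 2 - 4 * B * C)) {ν : ℂ} (hν : ν ^ n = 1)
    (hν2 : ν ^ 4 = 1 ∨ n ≠ 8) (hν3 : ν ^ 6 = 1 ∨ n ≠ 12)
    (h : (C : ℂ) + B * τ ^ 2 = ν * A) : IsStandard A B C := by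
  have hn0 : 0 < n := by omega
  have hτ1 : ‖τ‖ = 1 := hτ.norm'_eq_one hn0.ne'
  have hν1 : ‖ν‖ = 1 := Complex.norm_eq_one_of_pow_eq_one hν hn0.ne'
  have conj_eq : ∀ {w : ℂ}, ‖w‖ = 1 → w * starRingEnd ℂ w = 1 := fun hw => by
    rw [Complex.mul_conj, Complex.normSq_eq_norm_sq, hw]; norm_num
  have hτc := conj_eq hτ1
  have hνc := conj_eq hν1
  have hc : (C : ℂ) + B * (starRingEnd ℂ τ) ^ 2 = starRingEnd ℂ ν * A := by
    simpa using congrArg (starRingEnd ℂ) h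
  -- This is `|C + Bτ²|² = A²` multiplied by `τ²`. If `BC ≠ 0`, it forces `φ(n) ≤ 4`.
  have hrel : (B * C : ℂ) * τ ^ 4 + (B ^ 2 + C ^ 2 - A ^ 2) * τ ^ 2 + B * C = 0 := by
    linear_combination τ ^ 2 * (C + B * τ ^ 2) * hc + τ ^ 2 * (starRingEnd ℂ ν * A) * h
      + τ ^ 2 * A ^ 2 * hνc - (B * (C + B * τ ^ 2)) * (1 + τ * starRingEnd ℂ τ) * hτc
  by_cases hBC0 : B * C = 0
  · have h1 : ((B ^ 2 + C ^ 2 - A ^ 2 : ℚ) : ℂ) * τ ^ 2 = 0 := by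
      have h2 : (B * C : ℂ) = 0 := by exact_mod_cast hBC0
      push_cast
      linear_combination hrel - (τ ^ 4 + 1) * h2
    have h2 : B ^ 2 + C ^ 2 - A ^ 2 = 0 := by
      have := (mul_eq_zero.mp h1).resolve_right (pow_ne_zero 2 (hτ.ne_zero hn0.ne'))
      exact_mod_cast this
    rcases mul_eq_zero.mp hBC0 with rfl | rfl
    · exact Or.inr (Or.inl ⟨rfl, Or.inr (by linarith)⟩)
    · exact Or.inl ⟨rfl, Or.inr (by linarith)⟩
  exfalso
  have hφ : n.totient ≤ 4 := by
    by_contra hlt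
    have := coeff_eq_zero_of_sum_eq_zero hτ hn0 (d := 5) (by omega)
      ![B * C, 0, B ^ 2 + C ^ 2 - A ^ 2, 0, B * C] (by
        simp only [Fin.sum_univ_succ, Fin.sum_univ_zero]
        simp
        linear_combination hrel) 0
    exact hBC0 (by simpa using this)
  rcases four_dvd_of_totient_le_four h4 hn0.ne' hφ with rfl | rfl | rfl
  · omega
  · have hs : τ ^ 4 = -1 := (hτ.pow (a := 4) hn0 (by norm_num : 8 = 4 * 2)).eq_neg_one_of_two_right
    have hν4 : ν ^ 4 = 1 := hν2.resolve_right (by norm_num)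
    -- Here `τ²` is a square root of `-1`; the imaginary part gives `C² = B²`, and then the real
    -- part `-4B⁴ = A⁴`.
    have h2 : ((C : ℂ) + B * τ ^ 2) ^ 4 = A ^ 4 := by rw [h, mul_pow, hν4, one_mul]
    have hc := coeff_eq_zero_of_sum_eq_zero hτ hn0 (d := 4) (by decide)
      ![C ^ 4 - 6 * C ^ 2 * B ^ 2 + B ^ 4 - A ^ 4, 0, 4 * C * B * (C ^ 2 - B ^ 2), 0] (by
        simp only [Fin.sum_univ_succ, Fin.sum_univ_zero]
        simp
        linear_combination h2 - (6 * C ^ 2 * B ^ 2 + 4 * C * B ^ 3 * τ ^ 2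
          + B ^ 4 * (τ ^ 4 - 1)) * hs)
    have c0 := hc 0
    have c2 := hc 2
    simp only [Matrix.cons_val] at c0 c2
    have h3 : C ^ 2 = B ^ 2 := by
      have : B * C * (C ^ 2 - B ^ 2) = 0 := by linear_combination c2 / 4
      linarith [(mul_eq_zero.mp this).resolve_left hBC0]
    have h4 : B ^ 4 = 0 := by
      have h5 : -4 * B ^ 4 - A ^ 4 = 0 := by
        linear_combination c0 - (C ^ 2 - 5 * B ^ 2) * h3
      nlinarith [pow_nonneg (sq_nonneg A) 2, pow_nonneg (sq_nonneg B) 2]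
    exact hBC0 (by rw [pow_eq_zero_iff (by norm_num)] at h4; rw [h4, zero_mul])
  · have hs : τ ^ 4 = τ ^ 2 - 1 := by
      have h6 : τ ^ 6 = -1 :=
        (hτ.pow (a := 6) hn0 (by norm_num : 12 = 6 * 2)).eq_neg_one_of_two_right
      have h4 : τ ^ 2 + 1 ≠ 0 := fun h0 => by
        have : τ ^ 4 = 1 := by linear_combination (τ ^ 2 - 1) * h0
        have := Nat.le_of_dvd (by norm_num) (hτ.dvd_of_pow_eq_one _ this)
        omega
      refine mul_left_cancel₀ h4 ?_
      linear_combination h6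
    have hν6 : ν ^ 6 = 1 := hν3.resolve_right (by norm_num)
    obtain ⟨δ, hδ⟩ : ∃ δ : ℚ, ν ^ 3 = δ := by
      have : (ν ^ 3 - 1) * (ν ^ 3 + 1) = 0 := by linear_combination hν6
      rcases mul_eq_zero.mp this with h0 | h0
      · exact ⟨1, by push_cast; linear_combination h0⟩
      · exact ⟨-1, by push_cast; linear_combination h0⟩
    have h2 : ((C : ℂ) + B * τ ^ 2) ^ 3 = δ * A ^ 3 := by rw [h, mul_pow, hδ]
    have hc := coeff_eq_zero_of_sum_eq_zero hτ hn0 (d := 4) (by decide)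
      ![C ^ 3 - B ^ 3 - 3 * C * B ^ 2 - δ * A ^ 3, 0, 3 * B * C * (B + C), 0] (by
        simp only [Fin.sum_univ_succ, Fin.sum_univ_zero]
        simp
        linear_combination h2 - (3 * C * B ^ 2 + B ^ 3 * (τ ^ 2 + 1)) * hs)
    have hc' := coeff_eq_zero_of_sum_eq_zero hτ hn0 (d := 4) (by decide)
      ![0, 0, B * C + B ^ 2 + C ^ 2 - A ^ 2, 0] (by
        simp only [Fin.sum_univ_succ, Fin.sum_univ_zero]
        simp [-mul_eq_zero]
        linear_combination hrel - B * C * hs)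
    have c2 := hc 2
    have c2' := hc' 2
    simp only [Matrix.cons_val] at c2 c2'
    have hB : B = -C := by
      have : B * C * (B + C) = 0 := by linear_combination c2 / 3
      linarith [(mul_eq_zero.mp this).resolve_left hBC0]
    have hC : C ≠ 0 := right_ne_zero_of_mul hBC0
    -- From `B = -C` and `A² = C²` one gets `A² - 4BC = 5C²`.
    have h5 : IsSquare (5 : ℚ) := by
      obtain ⟨r, hr⟩ := hsq
      refine ⟨r / C, ?_⟩
      field_simp
      rw [hB] at hr c2'
      linear_combination hr + c2'
    exact absurd (Rat.isSquare_natCast_iff.mp (by exact_mod_cast h5 : IsSquare ((5 : ℕ) : ℚ)))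
      (by decide +kernel)

theorem isStandard_of_four_dvd (hτ : IsPrimitiveRoot τ n) (hn : 8 ≤ n) (h4 : 4 ∣ n)
    (hBC : B ≠ C) (hsq : IsSquare (A ^ 2 - 4 * B * C)) (hε : ε = 1 ∨ ε = -1)
    (h : (C : ℂ) + A * τ + B * τ ^ 2 = ε * τ ^ k * (B + A * τ + C * τ ^ 2)) :
    IsStandard A B C := by
  have hn0 : 0 < n := by omega
  have hτ0 : τ ≠ 0 := hτ.ne_zero hn0.ne'
  have hneg : (C : ℂ) + A * (-τ) + B * (-τ) ^ 2
      = ε * (-τ) ^ k * (B + A * (-τ) + C * (-τ) ^ 2) := by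
    have := aeval_pow_eq_zero hτ hn0 (P := Polynomial.C C + Polynomial.C A * Polynomial.X
      + Polynomial.C B * Polynomial.X ^ 2 - Polynomial.C ε * Polynomial.X ^ k *
        (Polynomial.C B + Polynomial.C A * Polynomial.X
          + Polynomial.C C * Polynomial.X ^ 2)) (by
      simp only [map_sub, map_add, map_mul, map_pow, Polynomial.aeval_C, Polynomial.aeval_X,
        eq_ratCast]
      linear_combination h) (neg_of_four_dvd hτ hn0 h4)
    simp only [map_sub, map_add, map_mul, map_pow, Polynomial.aeval_C, Polynomial.aeval_X,
      eq_ratCast] at this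
    linear_combination this
  have hε2 : (ε : ℂ) ^ 2 = 1 := by rcases hε with rfl | rfl <;> simp
  have hε4 : (ε : ℂ) ^ n = 1 := by
    obtain ⟨j, rfl⟩ := h4
    rw [show 4 * j = 2 * (2 * j) by ring, pow_mul, hε2, one_pow]
  have hμn : ((ε : ℂ) * τ ^ k) ^ n = 1 := by
    rw [mul_pow, hε4, pow_right_comm, hτ.pow_eq_one, one_pow, one_mul]
  have hs4 : (τ ^ 2) ^ 2 ≠ 1 := fun h0 => by
    rw [← pow_mul] at h0
    have := Nat.le_of_dvd (by norm_num) (hτ.dvd_of_pow_eq_one _ h0)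
    omega
  have hsn : (τ ^ 2) ^ n = 1 := by rw [pow_right_comm, hτ.pow_eq_one, one_pow]
  -- Half the sum and half the difference of the relations at `τ` and `-τ` isolate the even and the
  -- odd powers of `τ`.
  rcases Nat.even_or_odd k with hk | hk
  · rw [hk.neg_pow] at hneg
    have h1 : (C : ℂ) + B * τ ^ 2 = ε * τ ^ k * (B + C * τ ^ 2) := by
      linear_combination (h + hneg) / 2
    have h2 : (A : ℂ) * (τ * (1 - ε * τ ^ k)) = 0 := by
      linear_combination (h - hneg) / 2
    have hA : A = 0 := by
      rcases mul_eq_zero.mp h2 with h2 | h2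
      · exact_mod_cast h2
      · exfalso
        have h3 : (ε : ℂ) * τ ^ k = 1 := by
          linear_combination -(mul_eq_zero.mp h2).resolve_left hτ0
        rw [h3] at h1
        have h4 : ((C - B : ℚ) : ℂ) * (1 - τ ^ 2) = 0 := by push_cast; linear_combination h1
        rcases mul_eq_zero.mp h4 with h4 | h4
        · exact hBC (sub_eq_zero.mp (by exact_mod_cast h4 : C - B = 0)).symm
        · exact hs4 (by rw [← sub_eq_zero.mp h4, one_pow])
    subst hA
    by_cases hB : B = 0
    · exact Or.inr (Or.inl ⟨hB, Or.inl rfl⟩)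
    by_cases hC : C = 0
    · exact Or.inl ⟨hC, Or.inl rfl⟩
    refine Or.inr (Or.inr ⟨rfl, eq_neg_of_isSquare hn0 hsn hμn hs4 hB hC ?_ h1⟩)
    convert hsq using 1; ring
  · rw [hk.neg_pow] at hneg
    have h1 : (C : ℂ) + B * τ ^ 2 = (ε * τ ^ (k + 1)) * A := by
      rw [pow_succ]
      linear_combination (h + hneg) / 2
    obtain ⟨j, hj⟩ : ∃ j, k + 1 = 2 * j := ⟨(k + 1) / 2, by have := Nat.odd_iff.mp hk; omega⟩
    -- As `k + 1` is even, `τ^(k+1)` is a power of `τ²`, whose order is `n/2`.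
    have hpow : ∀ l, Even l → 2 * l = n → ((ε : ℂ) * τ ^ (k + 1)) ^ l = 1 := by
      rintro l ⟨i, rfl⟩ hl
      rw [mul_pow, hj, ← two_mul, pow_mul (ε : ℂ), hε2, one_pow, one_mul, ← pow_mul,
        show 2 * j * (2 * i) = n * j by rw [← hl]; ring, pow_mul, hτ.pow_eq_one, one_pow]
    refine isStandard_of_four_dvd_of_eq hτ hn h4 hBC hsq ?_ ?_ ?_ h1
    · rw [mul_pow, hε4, pow_right_comm, hτ.pow_eq_one, one_pow, one_mul]
    · by_cases h8 : n = 8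
      · exact Or.inl (hpow 4 (by decide) (by omega))
      · exact Or.inr h8
    · by_cases h8 : n = 12
      · exact Or.inl (hpow 6 (by decide) (by omega))
      · exact Or.inr h8

end FourDvd

end RationalAngles

namespace RationalAngles

/-! ### All orders together, and the return from `A, B, C` to `a, b`. -/

open IntermediateField in
theorem isStandard_of_pow_eq_one {n : ℕ} {τ : ℂ} (hτ : IsPrimitiveRoot τ n) (hn : 5 ≤ n)
    (hn6 : n ≠ 6) {A B C : ℚ} (hBC : B ≠ C) (hsq : IsSquare (A ^ 2 - 4 * B * C)) {μ : ℂ}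
    {m : ℕ} (hm : 0 < m) (hμ : μ ^ m = 1) (hne : (B : ℂ) + A * τ + C * τ ^ 2 ≠ 0)
    (h : (C : ℂ) + A * τ + B * τ ^ 2 = μ * (B + A * τ + C * τ ^ 2)) : IsStandard A B C := by
  have hn0 : 0 < n := by omega
  have hmem : ∀ {K : IntermediateField ℚ ℂ}, τ ∈ K → μ ∈ K := fun {K} hK => by
    rw [eq_div_of_mul_eq hne h.symm]
    have hq : ∀ q : ℚ, (q : ℂ) ∈ K := fun q => K.algebraMap_mem q
    exact div_mem (add_mem (add_mem (hq C) (mul_mem (hq A) hK)) (mul_mem (hq B) (pow_mem hK 2)))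
      (add_mem (add_mem (hq B) (mul_mem (hq A) hK)) (mul_mem (hq C) (pow_mem hK 2)))
  by_cases h4 : 4 ∣ n
  · obtain ⟨ε, k, hε, -, rfl⟩ := exists_eq_mul_pow_of_mem_adjoin hτ hn0
      (hmem (mem_adjoin_simple_self ℚ τ)) hm hμ
    exact isStandard_of_four_dvd hτ (by omega) h4 hBC hsq hε h
  rcases Nat.even_or_odd n with ⟨j, rfl⟩ | hodd
  · have hjodd : Odd j := by
      rw [← Nat.not_even_iff_odd]
      rintro ⟨i, rfl⟩
      exact h4 ⟨i, by ring⟩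
    have hτ' : IsPrimitiveRoot (-τ) j := by
      have h1 : τ ^ j = -1 := (hτ.pow (a := j) hn0 (by ring)).eq_neg_one_of_two_right
      have h2 : IsPrimitiveRoot (τ ^ 2) j := hτ.pow hn0 (by ring)
      obtain ⟨i, rfl⟩ := hjodd
      have h3 : -τ = (τ ^ 2) ^ (i + 1) := by
        rw [← pow_mul, show 2 * (i + 1) = (2 * i + 1) + 1 by ring, pow_succ, h1]; ring
      rw [h3]
      refine h2.pow_of_coprime _ ?_
      rw [show 2 * i + 1 = i + (i + 1) by ring]
      simp
    obtain ⟨ε, k, hε, hk, rfl⟩ := exists_eq_mul_pow_of_mem_adjoin hτ' (by omega)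
      (hmem (by simpa using neg_mem (mem_adjoin_simple_self ℚ (-τ)))) hm hμ
    have hj5 : 5 ≤ j := by
      have := Nat.odd_iff.mp hjodd
      omega
    have hstd : IsStandard (-A) B C := by
      refine isStandard_of_odd hτ' hjodd hj5 hBC (by simpa using hsq) hε hk ?_
      push_cast
      linear_combination h
    simpa [IsStandard] using hstd
  · obtain ⟨ε, k, hε, hk, rfl⟩ := exists_eq_mul_pow_of_mem_adjoin hτ hn0
      (hmem (mem_adjoin_simple_self ℚ τ)) hm hμ
    exact isStandard_of_odd hτ hodd hn hBC hsq hε hk h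

theorem IsStandard.eq_zero_or_eq {a b c d : ℚ} (hdet : a * d ≠ b * c)
    (h : IsStandard (a * c + b * d) (a * d) (b * c)) : a = 0 ∨ b = 0 ∨ a = b ∨ a = -b := by
  rcases h with ⟨h1, h2⟩ | ⟨h1, h2⟩ | ⟨h1, h2⟩
  · rcases mul_eq_zero.mp h1 with hb | rfl
    · exact Or.inr (Or.inl hb)
    · have hd : d ≠ 0 := by rintro rfl; simp at hdet
      rcases h2 with h2 | h2
      · simp [hd] at h2; exact Or.inr (Or.inl h2)
      · have : b ^ 2 * d ^ 2 = a ^ 2 * d ^ 2 := by linear_combination h2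
        have := mul_right_cancel₀ (pow_ne_zero 2 hd) this
        exact Or.inr (Or.inr (sq_eq_sq_iff_eq_or_eq_neg.mp this.symm))
  · rcases mul_eq_zero.mp h1 with ha | rfl
    · exact Or.inl ha
    · have hc : c ≠ 0 := by rintro rfl; simp at hdet
      rcases h2 with h2 | h2
      · simp [hc] at h2; exact Or.inl h2
      · have : a ^ 2 * c ^ 2 = b ^ 2 * c ^ 2 := by linear_combination h2
        have := mul_right_cancel₀ (pow_ne_zero 2 hc) this
        exact Or.inr (Or.inr (sq_eq_sq_iff_eq_or_eq_neg.mp this))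
  · have h3 : (c * d) * (a ^ 2 - b ^ 2) = 0 := by
      linear_combination a * d * h1 - b * d * h2
    rcases mul_eq_zero.mp h3 with h3 | h3
    · rcases mul_eq_zero.mp h3 with rfl | rfl
      · exact absurd (by simpa using h2) hdet
      · refine absurd ?_ hdet
        linear_combination -h2
    · exact Or.inr (Or.inr (sq_eq_sq_iff_eq_or_eq_neg.mp (by linarith)))

/-! ### Rational angles as equations in coordinates. -/

section Angles

open Complex ComplexConjugate

/-- For `z = w/v`, the quotient `z / conj z = exp(2i arg z)` is a root of unity iff `arg z` is a
rational multiple of `π`. -/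
theorem formRationalAngle_iff {v w : ℂ} : FormRationalAngle v w ↔
    (w * conj v).im ≠ 0 ∧ ∃ (μ : ℂ) (m : ℕ), 0 < m ∧ μ ^ m = 1 ∧
      w * conj v = μ * (conj w * v) := by
  by_cases hv : v = 0
  · simp [FormRationalAngle, hv]
  by_cases hw : w = 0
  · simp [FormRationalAngle, hw]
  have hcv : conj v ≠ 0 := by simpa using hv
  have hN : (v * conj v) = ((normSq v : ℝ) : ℂ) := mul_conj v
  have hN0 : normSq v ≠ 0 := by simpa using hv
  set z := w / v with hz
  have hz0 : z ≠ 0 := div_ne_zero hw hv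
  have hwz : w = z * v := by rw [hz]; field_simp
  have him : (w * conj v).im = z.im * normSq v := by
    rw [hwz, mul_assoc, hN, im_mul_ofReal]
  have hiff : ∀ μ : ℂ, w * conj v = μ * (conj w * v) ↔ z = μ * conj z := fun μ => by
    have hNC : v * conj v ≠ 0 := mul_ne_zero hv hcv
    rw [hwz, map_mul]
    constructor
    · intro h
      refine mul_right_cancel₀ hNC ?_
      linear_combination h
    · intro h
      linear_combination v * conj v * h
  have hpolar : (‖z‖ : ℂ) * exp (z.arg * I) = z := norm_mul_exp_arg_mul_I z
  have hpolar' : (‖z‖ : ℂ) * exp (-(z.arg * I)) = conj z := by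
    conv_rhs => rw [← hpolar, map_mul, ← exp_conj, map_mul, conj_I, conj_ofReal, conj_ofReal]
    rw [mul_neg]
  have hnorm : (‖z‖ : ℂ) ≠ 0 := by simpa using hz0
  have hiff2 : ∀ μ : ℂ, z = μ * conj z ↔ μ = exp (2 * z.arg * I) := fun μ => by
    have h1 : exp (2 * z.arg * I) = exp (z.arg * I) * exp (z.arg * I) := by
      rw [← exp_add]; ring_nf
    have h2 : exp (z.arg * I) * exp (-(z.arg * I)) = 1 := by
      rw [← exp_add, add_neg_cancel, exp_zero]
    rw [h1, ← hpolar']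
    constructor
    · intro h
      refine mul_left_cancel₀ hnorm ?_
      linear_combination (-exp (z.arg * I)) * h - exp (z.arg * I) * hpolar - μ * ‖z‖ * h2
    · rintro rfl
      linear_combination -hpolar - ‖z‖ * exp (z.arg * I) * h2
  simp only [FormRationalAngle, ← hz, him, hiff, hiff2, mul_ne_zero_iff, ne_eq, hv, hw, hN0,
    not_false_eq_true, true_and, and_true]
  refine and_congr_right fun _ => ⟨?_, ?_⟩
  · rintro ⟨q, hq⟩
    refine ⟨_, q.den, q.den_pos, ?_, rfl⟩
    rw [← exp_nat_mul, exp_eq_one_iff]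
    refine ⟨q.num, ?_⟩
    have h1 : (q.den : ℂ) * q = q.num := by exact_mod_cast Rat.den_mul_eq_num q
    rw [hq, ← h1]
    push_cast
    ring
  · rintro ⟨μ, m, hm, hμ, rfl⟩
    rw [← exp_nat_mul, exp_eq_one_iff] at hμ
    obtain ⟨j, hj⟩ := hμ
    refine ⟨j / m, ?_⟩
    have hmC : (m : ℂ) ≠ 0 := by exact_mod_cast hm.ne'
    have h1 : (z.arg : ℂ) = ((((j / m : ℚ) : ℝ) * Real.pi : ℝ) : ℂ) := by
      push_cast
      field_simp
      have h2I : (2 * I : ℂ) ≠ 0 := by simp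
      refine mul_left_cancel₀ h2I ?_
      linear_combination hj
    exact_mod_cast h1

theorem FormRationalAngle.symm {v w : ℂ} (h : FormRationalAngle v w) : FormRationalAngle w v := by
  rw [formRationalAngle_iff] at h ⊢
  obtain ⟨him, μ, m, hm, hμ, h⟩ := h
  have hμ0 : μ ≠ 0 := by rintro rfl; simp [hm.ne'] at hμ
  refine ⟨?_, μ⁻¹, m, hm, by rw [inv_pow, hμ, inv_one], ?_⟩
  · have : v * conj w = conj (w * conj v) := by simp [mul_comm]
    rw [this, conj_im]
    exact neg_ne_zero.mpr him
  · rw [mul_comm (conj v), h]; field_simp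

theorem formRationalAngle_coords_iff {l τ : ℂ} (hl : l ≠ 0) (hτ : ‖τ‖ = 1) (him : τ.im ≠ 0)
    (a b c d : ℚ) : FormRationalAngle (l * (a + b * τ)) (l * (c + d * τ)) ↔
      a * d ≠ b * c ∧ ∃ (μ : ℂ) (m : ℕ), 0 < m ∧ μ ^ m = 1 ∧
        ((b * c : ℚ) : ℂ) + (a * c + b * d : ℚ) * τ + (a * d : ℚ) * τ ^ 2
          = μ * ((a * d : ℚ) + (a * c + b * d : ℚ) * τ + (b * c : ℚ) * τ ^ 2) := by
  rw [formRationalAngle_iff]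
  have hττ : τ * conj τ = 1 := by rw [mul_conj, normSq_eq_norm_sq, hτ]; norm_num
  have hτ0 : τ ≠ 0 := left_ne_zero_of_mul_eq_one hττ
  have hN0 : normSq l ≠ 0 := by simpa using hl
  have hN : l * conj l = ((normSq l : ℝ) : ℂ) := mul_conj l
  have hNC : l * conj l ≠ 0 := by rw [hN]; exact_mod_cast hN0
  have h1 : l * (c + d * τ) * conj (l * (a + b * τ))
      = ((normSq l : ℝ) : ℂ) * ((a * c + b * d : ℝ) + (a * d : ℝ) * τ + (b * c : ℝ) * conj τ) := by
    rw [← hN]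
    simp
    linear_combination (l * conj l * b * d) * hττ
  have h1' : conj (l * (c + d * τ)) * (l * (a + b * τ))
      = ((normSq l : ℝ) : ℂ) * ((a * c + b * d : ℝ) + (b * c : ℝ) * τ + (a * d : ℝ) * conj τ) := by
    rw [← hN]
    simp
    linear_combination (l * conj l * b * d) * hττ
  refine and_congr ?_ (exists_congr fun μ => exists_congr fun m => and_congr_right fun _ =>
    and_congr_right fun _ => ?_)
  · have h2 : (l * (c + d * τ) * conj (l * (a + b * τ))).im
        = normSq l * ((((a * d - b * c : ℚ) : ℝ)) * τ.im) := by
      rw [h1, im_ofReal_mul, add_im, add_im, ofReal_im, im_ofReal_mul, im_ofReal_mul, conj_im]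
      push_cast
      ring
    rw [h2, mul_ne_zero_iff, mul_ne_zero_iff, Rat.cast_ne_zero, sub_ne_zero]
    simp [hN0, him]
  · rw [h1, h1', ← hN]
    push_cast
    constructor
    · intro h
      refine mul_left_cancel₀ hNC ?_
      linear_combination τ * h - l * conj l * (b * c - μ * a * d) * hττ
    · intro h
      refine mul_left_cancel₀ hτ0 ?_
      linear_combination l * conj l * h + l * conj l * (b * c - μ * a * d) * hττ

theorem FormRationalAngle.line_ne {v w : ℂ} (h : FormRationalAngle v w) : line v ≠ line w := by
  intro he
  have hw : w ∈ line v := by rw [he]; exact Submodule.mem_span_singleton_self w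
  obtain ⟨r, rfl⟩ := Submodule.mem_span_singleton.mp hw
  refine h.2.2.1 ?_
  rw [real_smul, mul_div_assoc, div_self h.1, mul_one, ofReal_im]

theorem line_ratCast_mul {q : ℚ} (hq : q ≠ 0) (v : ℂ) : line (q * v) = line v := by
  have h := Submodule.span_singleton_smul_eq (R := ℝ)
    (IsUnit.mk0 (q : ℝ) (by exact_mod_cast hq)) v
  simpa [line, real_smul] using h

end Angles

end RationalAngles

/-! ### Normal form of `V`, counting lines, and the 4-tuple. -/

namespace RationalAngles

open Complex

theorem mem_spaceOf {τ z : ℂ} : z ∈ spaceOf τ ↔ ∃ a b : ℚ, z = a + b * τ := by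
  simp only [spaceOf, Submodule.mem_span_pair, Rat.smul_def, mul_one, eq_comm]

theorem spaceOf_eq_of_eq_add_mul {τ σ : ℂ} {p q : ℚ} (hq : q ≠ 0) (h : σ = p + q * τ) :
    spaceOf τ = spaceOf σ := by
  have hqC : (q : ℂ) ≠ 0 := by exact_mod_cast hq
  ext z
  rw [mem_spaceOf, mem_spaceOf, h]
  constructor
  · rintro ⟨a, b, rfl⟩
    refine ⟨a - b / q * p, b / q, ?_⟩
    push_cast
    field_simp
    ring
  · rintro ⟨a, b, rfl⟩
    exact ⟨a + b * p, b * q, by push_cast; ring⟩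

theorem spaceOf_eq_eisensteinSpace {τ : ℂ} {e : ℚ} (he : e ^ 2 = 1)
    (h : τ ^ 2 + e * τ + 1 = 0) : spaceOf τ = eisensteinSpace := by
  have heC : (e : ℂ) ^ 2 = 1 := by exact_mod_cast he
  have h3 : ((Real.sqrt 3 : ℝ) : ℂ) ^ 2 = 3 := by
    rw [← ofReal_pow, Real.sq_sqrt (by norm_num)]; norm_num
  have h1 : (2 * τ + e) ^ 2 = ((Real.sqrt 3 : ℂ) * I) ^ 2 := by
    rw [mul_pow, h3, I_sq]
    linear_combination 4 * h + heC
  rcases sq_eq_sq_iff_eq_or_eq_neg.mp h1 with h1 | h1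
  · exact spaceOf_eq_of_eq_add_mul (p := e) (q := 2) (by norm_num)
      (by rw [← h1]; push_cast; ring)
  · exact spaceOf_eq_of_eq_add_mul (p := -e) (q := -2) (by norm_num)
      (by push_cast; linear_combination h1)

theorem spaceOf_eq_gaussianSpace {τ : ℂ} (h : τ ^ 2 = -1) : spaceOf τ = gaussianSpace := by
  rw [← I_sq] at h
  rcases sq_eq_sq_iff_eq_or_eq_neg.mp h with h | h
  · rw [h]; rfl
  · exact spaceOf_eq_of_eq_add_mul (p := 0) (q := -1) (by norm_num) (by rw [h]; simp)

theorem exists_primitiveRoot_of_isSuperrectangular {V : Submodule ℚ ℂ} (hV : IsSpace V)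
    (hsr : IsSuperrectangular V) (hi : ¬ Homothetic V gaussianSpace)
    (h3 : ¬ Homothetic V eisensteinSpace) :
    ∃ (l τ : ℂ) (n : ℕ), l ≠ 0 ∧ IsPrimitiveRoot τ n ∧ 5 ≤ n ∧ n ≠ 6 ∧ τ.im ≠ 0 ∧
      ∀ v, v ∈ V ↔ ∃ a b : ℚ, v = l * (a + b * τ) := by
  obtain ⟨τ, ⟨N, hN, hτN⟩, l, hl, hmap⟩ := hsr
  set n := orderOf τ with hn
  have hτ : IsPrimitiveRoot τ n := IsPrimitiveRoot.orderOf τ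
  have hn0 : 0 < n := (isOfFinOrder_iff_pow_eq_one.mpr ⟨N, hN, hτN⟩).orderOf_pos
  have hmem : ∀ v, v ∈ V ↔ ∃ a b : ℚ, v = l⁻¹ * (a + b * τ) := fun v => by
    have h1 : v ∈ V ↔ l * v ∈ spaceOf τ := by
      rw [hmap, Submodule.mem_map]
      constructor
      · exact fun hv => ⟨v, hv, rfl⟩
      · rintro ⟨w, hw, hwv⟩
        rwa [← mul_left_cancel₀ hl hwv]
    rw [h1, mem_spaceOf]
    refine exists_congr fun a => exists_congr fun b => ?_
    rw [eq_inv_mul_iff_mul_eq₀ hl]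
  have him : τ.im ≠ 0 := fun h0 => by
    obtain ⟨v, hv, w, hw, hind⟩ := hV.exists_indep
    obtain ⟨a, b, rfl⟩ := (hmem v).mp hv
    obtain ⟨c, d, rfl⟩ := (hmem w).mp hw
    have hre : τ = (τ.re : ℂ) := by apply Complex.ext <;> simp [h0]
    rw [LinearIndependent.pair_iff] at hind
    have h1 := hind (c + d * τ.re) (-(a + b * τ.re)) (by
      rw [hre]
      simp only [real_smul]
      push_cast
      simp only [ofReal_re]
      ring)
    have h2 : ((a : ℂ) + b * τ) = 0 := by
      rw [hre]
      exact_mod_cast neg_eq_zero.mp h1.2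
    have := hind 1 0 (by rw [h2]; simp)
    simp at this
  refine ⟨l⁻¹, τ, n, inv_ne_zero hl, hτ, ?_, ?_, him, hmem⟩
  · by_contra hlt
    obtain h | h | h | h : n = 1 ∨ n = 2 ∨ n = 3 ∨ n = 4 := by omega
    · rw [h] at hτ
      rw [IsPrimitiveRoot.one_right_iff] at hτ
      simp [hτ] at him
    · rw [h] at hτ
      simp [hτ.eq_neg_one_of_two_right] at him
    · rw [h] at hτ
      have h1 := hτ.geom_sum_eq_zero (by norm_num)
      simp [Finset.sum_range_succ] at h1
      refine h3 ⟨l, hl, ?_⟩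
      rw [← hmap, ← spaceOf_eq_eisensteinSpace (e := 1) (by norm_num)
        (by push_cast; linear_combination h1)]
    · rw [h] at hτ
      refine hi ⟨l, hl, ?_⟩
      rw [← hmap, ← spaceOf_eq_gaussianSpace
        (hτ.pow (a := 2) (by norm_num) (by norm_num : 4 = 2 * 2)).eq_neg_one_of_two_right]
  · intro h
    rw [h] at hτ
    have h6 : τ ^ 3 = -1 :=
      (hτ.pow (a := 3) (by norm_num) (by norm_num : 6 = 3 * 2)).eq_neg_one_of_two_right
    have h1 : τ + 1 ≠ 0 := fun h0 => him (by rw [eq_neg_of_add_eq_zero_left h0]; simp)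
    refine h3 ⟨l, hl, ?_⟩
    rw [← hmap, ← spaceOf_eq_eisensteinSpace (e := -1) (by norm_num)
      (mul_left_cancel₀ h1 (by push_cast; linear_combination h6))]

theorem IsRationalTuple.injOn_line {V : Submodule ℚ ℂ} {n : ℕ} {T : Finset ℂ}
    (hT : IsRationalTuple V n T) : Set.InjOn line (T : Set ℂ) := fun v hv w hw h => by
  by_contra hne
  exact (hT.2.2 v hv w hw hne).line_ne h

theorem IsRationalTuple.ncard_linesOf {V : Submodule ℚ ℂ} {n : ℕ} {T : Finset ℂ}
    (hT : IsRationalTuple V n T) : (linesOf T).ncard = n := by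
  rw [linesOf, hT.injOn_line.ncard_image, Set.ncard_coe_finset, hT.1]

theorem finite_linesOf (T : Finset ℂ) : (linesOf T).Finite := T.finite_toSet.image _

theorem IsRationalTuple.linesOf_subset {V : Submodule ℚ ℂ} {n : ℕ} {T : Finset ℂ}
    {L : Set (Submodule ℝ ℂ)}
    (hL : ∀ v ∈ V, ∀ w ∈ V, FormRationalAngle v w → line v ∈ L)
    (hn : 2 ≤ n) (hT : IsRationalTuple V n T) : linesOf T ⊆ L := by
  rintro _ ⟨v, hv, rfl⟩
  obtain ⟨w, hw, hne⟩ := Finset.exists_mem_ne (by rw [hT.1]; omega) v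
  exact hL v (hT.2.1 v hv).1 w (hT.2.1 w hw).1 (hT.2.2 v hv w hw hne.symm)

/-- If the sides of all rational angles of `V` lie on the lines of one rational `n`-tuple, then
`(n)` is the exact type of `V`. -/
theorem IsRationalTuple.hasExactType {V : Submodule ℚ ℂ} {n : ℕ} {T : Finset ℂ} (hn : 2 ≤ n)
    (hT : IsRationalTuple V n T)
    (hL : ∀ v ∈ V, ∀ w ∈ V, FormRationalAngle v w → line v ∈ linesOf T) :
    HasExactType V [n] := by
  classical
  refine ⟨⟨by simpa using hn, fun _ => T, fun i => ?_, fun i j hij => ?_⟩, ?_⟩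
  · simpa using hT
  · exact absurd (Subsingleton.elim (α := Fin 1) i j) hij
  · rintro s ⟨hs, S, hS, hdisj⟩
    -- All tuples go into the single one available; being disjoint sets of lines inside `linesOf T`,
    -- their sizes add up to at most `n`.
    refine ⟨fun _ => (0 : Fin 1), fun j => ?_⟩
    have hfin : ∀ i, (linesOf (S i)).Finite := fun i => finite_linesOf _
    have hcard : ∀ i, (hfin i).toFinset.card = s.get i := fun i => by
      rw [← Set.ncard_eq_toFinset_card _ (hfin i), (hS i).ncard_linesOf]
    have hle : (Finset.univ.biUnion fun i => (hfin i).toFinset).card ≤ n := by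
      rw [← hT.ncard_linesOf, Set.ncard_eq_toFinset_card _ (finite_linesOf T)]
      refine Finset.card_le_card fun x hx => ?_
      simp only [Finset.mem_biUnion, Finset.mem_univ, true_and, Set.Finite.mem_toFinset] at hx ⊢
      obtain ⟨i, hi⟩ := hx
      exact (hS i).linesOf_subset hL (hs _ (List.get_mem s i)) hi
    rw [Finset.card_biUnion fun i _ j _ hij => by
      simpa using hdisj i j hij, Finset.sum_congr rfl fun i _ => hcard i] at hle
    have hj : [n].get j = n := by simp
    rw [hj]
    exact (Finset.sum_le_sum_of_subset (Finset.filter_subset _ _)).trans hle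

/-- The sides and the diagonals of the parallelogram spanned by `l` and `l τ`. -/
noncomputable def sidesAndDiagonals (l τ : ℂ) : Finset ℂ :=
  {l * ((1 : ℚ) + (0 : ℚ) * τ), l * ((0 : ℚ) + (1 : ℚ) * τ),
    l * ((1 : ℚ) + (1 : ℚ) * τ), l * ((1 : ℚ) + (-1 : ℚ) * τ)}

theorem isRationalTuple_sidesAndDiagonals {V : Submodule ℚ ℂ} {l τ : ℂ} {n : ℕ} (hl : l ≠ 0)
    (hn : 0 < n) (hτ : τ ^ n = 1) (him : τ.im ≠ 0)
    (hmem : ∀ a b : ℚ, l * (a + b * τ) ∈ V) :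
    IsRationalTuple V 4 (sidesAndDiagonals l τ) := by
  have hnorm : ‖τ‖ = 1 := norm_eq_one_of_pow_eq_one hτ hn.ne'
  have hτ0 : τ ≠ 0 := fun h => him (by simp [h])
  have hneg : ∀ {μ : ℂ}, μ ^ n = 1 → (-μ) ^ (2 * n) = 1 := fun {μ} h => by
    rw [mul_comm, pow_mul, neg_pow, h, mul_one, ← pow_mul, mul_comm, pow_mul]; simp
  have hinv : τ⁻¹ ^ n = 1 := by rw [inv_pow, hτ, inv_one]
  have h12 := (formRationalAngle_coords_iff hl hnorm him 1 0 0 1).mpr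
    ⟨by norm_num, τ ^ 2, n, hn, by rw [pow_right_comm, hτ, one_pow], by push_cast; ring⟩
  have h13 := (formRationalAngle_coords_iff hl hnorm him 1 0 1 1).mpr
    ⟨by norm_num, τ, n, hn, hτ, by push_cast; ring⟩
  have h14 := (formRationalAngle_coords_iff hl hnorm him 1 0 1 (-1)).mpr
    ⟨by norm_num, -τ, 2 * n, by omega, hneg hτ, by push_cast; ring⟩
  have h23 := (formRationalAngle_coords_iff hl hnorm him 0 1 1 1).mpr
    ⟨by norm_num, τ⁻¹, n, hn, hinv, by push_cast; field_simp; ring⟩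
  have h24 := (formRationalAngle_coords_iff hl hnorm him 0 1 1 (-1)).mpr
    ⟨by norm_num, -τ⁻¹, 2 * n, by omega, hneg hinv, by push_cast; field_simp; ring⟩
  have h34 := (formRationalAngle_coords_iff hl hnorm him 1 1 1 (-1)).mpr
    ⟨by norm_num, -1, 2, by norm_num, by norm_num, by push_cast; ring⟩
  have hne : ∀ {v w : ℂ}, FormRationalAngle v w → v ≠ w := fun h he => h.line_ne (by rw [he])
  refine ⟨?_, ?_, ?_⟩
  · rw [sidesAndDiagonals, Finset.card_insert_of_notMem, Finset.card_insert_of_notMem,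
      Finset.card_pair (hne h34)]
    · simp only [Finset.mem_insert, Finset.mem_singleton, not_or]
      exact ⟨hne h23, hne h24⟩
    · simp only [Finset.mem_insert, Finset.mem_singleton, not_or]
      exact ⟨hne h12, hne h13, hne h14⟩
  · intro v hv
    simp only [sidesAndDiagonals, Finset.mem_insert, Finset.mem_singleton] at hv
    rcases hv with rfl | rfl | rfl | rfl
    · exact ⟨hmem _ _, h12.1⟩
    · exact ⟨hmem _ _, h12.2.1⟩
    · exact ⟨hmem _ _, h13.2.1⟩
    · exact ⟨hmem _ _, h14.2.1⟩
  · intro v hv w hw hvw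
    simp only [sidesAndDiagonals, Finset.mem_insert, Finset.mem_singleton] at hv hw
    rcases hv with rfl | rfl | rfl | rfl <;> rcases hw with rfl | rfl | rfl | rfl <;>
      first
      | exact absurd rfl hvw
      | assumption
      | exact FormRationalAngle.symm (by assumption)

theorem line_mem_linesOf_sidesAndDiagonals {l τ : ℂ} {n : ℕ} (hl : l ≠ 0)
    (hτ : IsPrimitiveRoot τ n) (hn : 5 ≤ n) (hn6 : n ≠ 6) (him : τ.im ≠ 0) {a b c d : ℚ}
    (h : FormRationalAngle (l * (a + b * τ)) (l * (c + d * τ))) :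
    line (l * (a + b * τ)) ∈ linesOf (sidesAndDiagonals l τ) := by
  have hn0 : n ≠ 0 := by omega
  have hv := h.1
  have hw := h.2.1
  rw [formRationalAngle_coords_iff hl (hτ.norm'_eq_one hn0) him] at h
  obtain ⟨hdet, μ, m, hm, hμ, heq⟩ := h
  have hstd : IsStandard (a * c + b * d) (a * d) (b * c) := by
    -- The factor `B + Aτ + Cτ²` equals `(a + bτ)(d + cτ)`, hence is nonzero.
    refine isStandard_of_pow_eq_one hτ hn hn6 hdet ⟨a * c - b * d, by ring⟩ hm hμ ?_ heq
    intro h0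
    have h1 : (l * (a + b * τ)) * ((d : ℂ) + c * τ) = 0 := by
      push_cast at h0
      linear_combination l * h0
    have h2 := (mul_eq_zero.mp h1).resolve_left hv
    have hc : c = 0 := by
      have := congrArg Complex.im h2
      simpa [him] using this
    have hd : d = 0 := by simpa [hc] using h2
    exact hw (by simp [hc, hd])
  have hmem : ∀ {p q r : ℚ}, r ≠ 0 → l * ((p : ℂ) + q * τ) ∈ sidesAndDiagonals l τ →
      a = r * p → b = r * q → line (l * (a + b * τ)) ∈ linesOf (sidesAndDiagonals l τ) := by
    rintro p q r hr hpq rfl rfl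
    refine ⟨_, hpq, ?_⟩
    rw [← line_ratCast_mul hr]
    congr 1
    push_cast
    ring
  have hab : ¬ (a = 0 ∧ b = 0) := by
    rintro ⟨rfl, rfl⟩
    simp at hv
  have hin : ∀ x : ℂ, x ∈ sidesAndDiagonals l τ ↔ x = l * ((1 : ℚ) + (0 : ℚ) * τ) ∨
      x = l * ((0 : ℚ) + (1 : ℚ) * τ) ∨ x = l * ((1 : ℚ) + (1 : ℚ) * τ) ∨
        x = l * ((1 : ℚ) + (-1 : ℚ) * τ) := fun x => by
    simp only [sidesAndDiagonals, Finset.mem_insert, Finset.mem_singleton]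
  by_cases hb : b = 0
  · exact hmem (p := 1) (q := 0) (r := a) (fun ha => hab ⟨ha, hb⟩)
      ((hin _).mpr (Or.inl rfl)) (by ring) (by simp [hb])
  rcases hstd.eq_zero_or_eq hdet with ha | hb' | hab' | hab'
  · exact hmem (p := 0) (q := 1) (r := b) hb
      ((hin _).mpr (Or.inr (Or.inl rfl))) (by simp [ha]) (by ring)
  · exact absurd hb' hb
  · exact hmem (p := 1) (q := 1) (r := b) hb
      ((hin _).mpr (Or.inr (Or.inr (Or.inl rfl)))) (by rw [hab']; ring) (by ring)
  · exact hmem (p := 1) (q := -1) (r := -b) (neg_ne_zero.mpr hb)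
      ((hin _).mpr (Or.inr (Or.inr (Or.inr rfl)))) (by rw [hab']; ring) (by ring)

end RationalAngles

theorem theorem7p1 (V : Submodule ℚ ℂ) (hV : RationalAngles.IsSpace V)
    (hsr : RationalAngles.IsSuperrectangular V)
    (hi : ¬ RationalAngles.Homothetic V RationalAngles.gaussianSpace)
    (h3 : ¬ RationalAngles.Homothetic V RationalAngles.eisensteinSpace) :
    RationalAngles.HasExactType V [4] ∧
    ∃ T : Finset ℂ, RationalAngles.IsRationalTuple V 4 T ∧
      (∀ T' : Finset ℂ, RationalAngles.IsRationalTuple V 4 T' → RationalAngles.TupleEquiv T' T) ∧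
      (∀ v ∈ V, ∀ w ∈ V, RationalAngles.FormRationalAngle v w →
        ∃ v' ∈ T, ∃ w' ∈ T, RationalAngles.AngleEquiv v w v' w') := by
  obtain ⟨l, τ, n, hl, hτ, hn, hn6, him, hmem⟩ :=
    RationalAngles.exists_primitiveRoot_of_isSuperrectangular hV hsr hi h3
  have hT := RationalAngles.isRationalTuple_sidesAndDiagonals (V := V) hl (by omega)
    hτ.pow_eq_one him fun a b => (hmem _).mpr ⟨a, b, rfl⟩
  have hL : ∀ v ∈ V, ∀ w ∈ V, RationalAngles.FormRationalAngle v w →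
      RationalAngles.line v ∈ RationalAngles.linesOf (RationalAngles.sidesAndDiagonals l τ) := by
    intro v hv w hw h
    obtain ⟨a, b, rfl⟩ := (hmem v).mp hv
    obtain ⟨c, d, rfl⟩ := (hmem w).mp hw
    exact RationalAngles.line_mem_linesOf_sidesAndDiagonals hl hτ hn hn6 him h
  refine ⟨hT.hasExactType (by norm_num) hL, _, hT, fun T' hT' => ?_, fun v hv w hw h => ?_⟩
  · exact Set.eq_of_subset_of_ncard_le (hT'.linesOf_subset hL (by norm_num))
      (by rw [hT.ncard_linesOf, hT'.ncard_linesOf]) (RationalAngles.finite_linesOf _)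
  · obtain ⟨v', hv', hvv'⟩ := hL v hv w hw h
    obtain ⟨w', hw', hww'⟩ := hL w hw v hv h.symm
    exact ⟨v', hv', w', hw', Or.inl ⟨hvv'.symm, hww'.symm⟩⟩
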